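/- Call a Lie group $G$ of dimension $2n+1$ a \emph{K-contact Lie group} if it carries a right-invariant contact form $\eta$ (so $\eta\wedge(d\eta)^n$ vanishes nowhere), with Reeb field $\xi$, and a right-invariant Riemannian metric $g$ that form a contact metric structure (there is a field $\varphi$ of endomorphisms of $TG$ with $g(\cdot,\xi)=\eta$, $\varphi^2=-\mathrm{id}+\eta\otimes\xi$, $d\eta(X,Y)=g(X,\varphi Y)$) for which $\xi$ is a Killing field of $g$. For a 1-form $\omega$, the characteristic distribution is $\ker\omega\cap\ker d\omega$; when it is tangent to a regular foliation, that foliation is the characteristic foliation of $\omega$. A pair $(\alpha,\beta)$ of 1-forms on a manifold of dimension $2n+2m+2$ is a contact pair of type $(n,m)$ if $\alpha$ has class $2n+1$ (that is, $\alpha\wedge(d\alpha)^n\neq0$ everywhere and $(d\alpha)^{n+1}=0$), $\beta$ has class $2m+1$, and $\alpha\wedge(d\alpha)^n\wedge\beta\wedge(d\beta)^m$ is a volume form. Let $n,m\ge 0$, and let $G_1$ and $G_2$ be K-contact Lie groups of dimensions $2n+1$ and $2m+1$. Let $\mathcal F^1$ (resp. $\mathcal F^2$) be a codimension-one foliation of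 $G_1$ (resp. $G_2$) defined by a nowhere vanishing smooth closed right-invariant 1-form $\alpha_0$ (resp. $\beta_0$) that is harmonic, $(d\delta+\delta d)\alpha_0=0$ (resp. $(d\delta+\delta d)\beta_0=0$), with respect to some Riemannian metric on $G_1$ (resp. $G_2$). Let $p_i:G=G_1\times G_2\to G_i$ be the projections. Then the pair of product foliations $(p_1^*\mathcal F^1,p_2^*\mathcal F^2)$ on $G$ (whose leaves are the $L_1\times G_2$ and the $G_1\times L_2$, with $L_i$ a leaf of $\mathcal F^i$) can be linearly deformed into a pair of transverse characteristic foliations, those of a contact pair. Precisely, $p_1^*\alpha_0$ and $p_2^*\beta_0$ are closed, linearly independent at every point, and define the two product foliations, which are their characteristic foliations; and there are smooth right-invariant 1-forms $\alpha$ on $G_1$ and $\beta$ on $G_2$ such that for every $t>0$ the forms $$\alpha_t=p_1^*\alpha_0+t\,p_1^*\alpha,\qquad \beta_t=p_2^*\beta_0+t\,p_2^*\beta$$ are a contact pair of type $(n,m)$ on $G$, and their characteristic distributions are tangent to regular foliations of codimensions $2n+1$ and $2m+1$ which are transverse and complementary (their tangent spaces at each point are complementary subspaces of the tangent space of $G$).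 -/

import Mathlib

open scoped Manifold ContDiff

/-! ### Exterior algebra of a real vector space -/

section Wedge

variable {V : Type*} [AddCommGroup V] [Module ℝ V]

/-- The wedge product of alternating forms, as the signed sum over `(p, q)`-shuffles. -/
noncomputable def wedge {p q : ℕ} (a : V [⋀^Fin p]→ₗ[ℝ] ℝ) (b : V [⋀^Fin q]→ₗ[ℝ] ℝ) :
    V [⋀^Fin (p + q)]→ₗ[ℝ] ℝ :=
  ((LinearMap.mul' ℝ ℝ).compAlternatingMap (AlternatingMap.domCoprod a b)).domDomCongr
    finSumFinEquiv

/-- The wedge power `θ ∧ ⋯ ∧ θ` (`k` factors) of a 2-form `θ`; the power `0` is the constant `1`. -/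
noncomputable def wedgePow (θ : V [⋀^Fin 2]→ₗ[ℝ] ℝ) : (k : ℕ) → V [⋀^Fin (2 * k)]→ₗ[ℝ] ℝ
  | 0 => (AlternatingMap.constOfIsEmpty ℝ V (Fin 0) (1 : ℝ) : V [⋀^Fin 0]→ₗ[ℝ] ℝ)
  | k + 1 => wedge (wedgePow θ k) θ

/-- A linear form viewed as an alternating form of degree `1`. -/
noncomputable def linForm (a : V →ₗ[ℝ] ℝ) : V [⋀^Fin 1]→ₗ[ℝ] ℝ :=
  AlternatingMap.ofSubsingleton ℝ V ℝ (0 : Fin 1) a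

/-- The form `a ∧ θ ∧ ⋯ ∧ θ` with `k` factors `θ`. -/
noncomputable def contactWedge (k : ℕ) (a : V →ₗ[ℝ] ℝ) (θ : V [⋀^Fin 2]→ₗ[ℝ] ℝ) :
    V [⋀^Fin (1 + 2 * k)]→ₗ[ℝ] ℝ :=
  wedge (linForm a) (wedgePow θ k)

end Wedge

/-! ### Differential forms and distributions on a boundaryless manifold -/

section Forms

variable {E : Type*} [NormedAddCommGroup E] [NormedSpace ℝ E] {H : Type*} [TopologicalSpace H]
  (I : ModelWithCorners ℝ E H) {M : Type*} [TopologicalSpace M] [ChartedSpace H M]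

variable (M) in
/-- Fields of linear forms on `M`. -/
abbrev OneForm : Type _ := (x : M) → (TangentSpace I x →L[ℝ] ℝ)

variable (M) in
/-- Distributions (fields of tangent subspaces) on `M`. -/
abbrev TangentDist : Type _ := (x : M) → Submodule ℝ (TangentSpace I x)

variable {I}

/-- Smooth 1-forms are the smooth sections of the cotangent bundle. -/
def SmoothForm [IsManifold I ∞ M] (θ : OneForm I M) : Prop :=
  ContMDiff I (I.prod 𝓘(ℝ, E →L[ℝ] ℝ)) ∞
    (fun x => Bundle.TotalSpace.mk' (E →L[ℝ] ℝ)
      (E := fun x : M => TangentSpace I x →L[ℝ] ℝ) x (θ x))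

/-- The differential at `x` of the preferred chart at `x`. -/
noncomputable def chartDeriv (x : M) : TangentSpace I x →L[ℝ] E :=
  mfderiv I 𝓘(ℝ, E) (extChartAt I x) x

/-- The differential at `y` of the inverse of the preferred chart at `x`. -/
noncomputable def chartSymmDeriv (x : M) (y : E) :
    E →L[ℝ] TangentSpace I ((extChartAt I x).symm y) :=
  mfderiv 𝓘(ℝ, E) I (extChartAt I x).symm y

/-- The 1-form `θ` read in the preferred chart at `x`, as a 1-form on the model space. -/
noncomputable def chartForm (θ : OneForm I M) (x : M) (y : E) : E →L[ℝ] ℝ :=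
  (θ ((extChartAt I x).symm y)).comp (chartSymmDeriv x y)

/-- The exterior derivative of a 1-form, computed at `x` in the preferred chart at `x`;
`dθ(X, Y) = X θ(Y) - Y θ(X) - θ([X, Y])`. -/
noncomputable def extD (θ : OneForm I M) (x : M) : (TangentSpace I x) [⋀^Fin 2]→ₗ[ℝ] ℝ :=
  (extDeriv (fun y : E =>
      ContinuousAlternatingMap.ofSubsingleton ℝ E ℝ (0 : Fin 1) (chartForm θ x y))
    (extChartAt I x x)).toAlternatingMap.compLinearMap
      (chartDeriv x).toLinearMap

def ClosedForm (θ : OneForm I M) : Prop := ∀ x, extD θ x = 0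

/-- The form `θ ∧ (dθ)ᵏ` at `x`. -/
noncomputable def classForm (k : ℕ) (θ : OneForm I M) (x : M) :
    (TangentSpace I x) [⋀^Fin (1 + 2 * k)]→ₗ[ℝ] ℝ :=
  contactWedge k (θ x).toLinearMap (extD θ x)

/-- The 1-form `θ` has constant class `2k+1`. -/
def HasClass (k : ℕ) (θ : OneForm I M) : Prop :=
  ∀ x, classForm k θ x ≠ 0 ∧ wedgePow (extD θ x) (k + 1) = 0

/-- `η` is a contact form on the `(2n+1)`-dimensional manifold `M`. -/
structure IsContactForm [IsManifold I ∞ M] (n : ℕ) (η : OneForm I M) : Prop where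
  smooth : SmoothForm η
  dim : Module.finrank ℝ E = 2 * n + 1
  nondegenerate : ∀ x, classForm n η x ≠ 0

/-- `(α, β)` is a contact pair of type `(k, l)` on the `(2k+2l+2)`-dimensional manifold `M`. -/
structure IsContactPair [IsManifold I ∞ M] (k l : ℕ) (α β : OneForm I M) : Prop where
  smooth_left : SmoothForm α
  smooth_right : SmoothForm β
  dim : Module.finrank ℝ E = 2 * k + 2 * l + 2
  class_left : HasClass k α
  class_right : HasClass l β
  volume : ∀ x, wedge (classForm k α x) (classForm l β x) ≠ 0

/-- The characteristic distribution `ker θ ∩ ker dθ`. -/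
noncomputable def charDist (θ : OneForm I M) : TangentDist I M := fun x =>
  { carrier := {v | θ x v = 0 ∧ ∀ w : TangentSpace I x, extD θ x ![v, w] = 0}
    add_mem' := by
      rintro a b ⟨ha, ha'⟩ ⟨hb, hb'⟩
      refine ⟨by rw [map_add, ha, hb, add_zero], fun w => ?_⟩
      have e : ∀ c : TangentSpace I x, Function.update ![a, w] 0 c = ![c, w] := by
        intro c; ext i; fin_cases i <;> rfl
      have h2 := (extD θ x).map_update_add ![a, w] 0 a b
      rw [e, e, e, ha', hb', add_zero] at h2
      exact h2
    zero_mem' := ⟨map_zero _, fun w => (extD θ x).map_coord_zero (0 : Fin 2) rfl⟩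
    smul_mem' := by
      rintro c a ⟨ha, ha'⟩
      refine ⟨by rw [map_smul, ha, smul_zero], fun w => ?_⟩
      have e : ∀ c : TangentSpace I x, Function.update ![a, w] 0 c = ![c, w] := by
        intro c; ext i; fin_cases i <;> rfl
      have h2 := (extD θ x).map_update_smul ![a, w] 0 c a
      rw [e, e, ha', smul_zero] at h2
      exact h2 }

/-- The distribution `D` is tangent to a regular foliation of codimension `q`: locally it is the
kernel of the differential of a submersion to `ℝ^q`. -/
def IsFoliation (q : ℕ) (D : TangentDist I M) : Prop :=
  ∀ x : M, ∃ U : Set M, IsOpen U ∧ x ∈ U ∧ ∃ f : M → EuclideanSpace ℝ (Fin q),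
    ContMDiffOn I (𝓡 q) ∞ f U ∧ ∀ y ∈ U,
      Function.Surjective (mfderiv I (𝓡 q) f y) ∧
      D y = LinearMap.ker (mfderiv I (𝓡 q) f y).toLinearMap

/-- `D` is (tangent to) a codimension one foliation defined by the nowhere vanishing 1-form `θ`. -/
def DefinesFoliation (θ : OneForm I M) (D : TangentDist I M) : Prop :=
  IsFoliation 1 D ∧ ∀ x, θ x ≠ 0 ∧ D x = LinearMap.ker (θ x).toLinearMap

/-- `t ↦ (α₀ + t α, β₀ + t β)` is a linear deformation of the pair `(α₀, β₀)` of pointwise linearly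
independent closed 1-forms. -/
structure IsLinearDeformation [IsManifold I ∞ M] (α₀ β₀ α β : OneForm I M)
    (A B : ℝ → OneForm I M) : Prop where
  smooth : SmoothForm α₀ ∧ SmoothForm β₀ ∧ SmoothForm α ∧ SmoothForm β
  closed_left : ClosedForm α₀
  closed_right : ClosedForm β₀
  independent : ∀ x, LinearIndependent ℝ ![α₀ x, β₀ x]
  left_eq : ∀ t, A t = α₀ + t • α
  right_eq : ∀ t, B t = β₀ + t • β

section Pullback

variable {E' : Type*} [NormedAddCommGroup E'] [NormedSpace ℝ E'] {H' : Type*} [TopologicalSpace H']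
  {I' : ModelWithCorners ℝ E' H'} {N : Type*} [TopologicalSpace N] [ChartedSpace H' N]

variable (I I') in
noncomputable def pullForm (f : M → N) (θ : OneForm I' N) : OneForm I M := fun x =>
  (θ (f x)).comp (mfderiv I I' f x)

/-- The preimage distribution `(df)⁻¹ D`. For a projection of a product onto a factor and `D`
tangent to a foliation with leaves `L`, it is tangent to the product foliation, whose leaves are the
products of the leaves `L` with the other factor. -/
noncomputable def pullDist (f : M → N) (D : TangentDist I' N) : TangentDist I M := fun x =>
  (D (f x)).comap (mfderiv I I' f x).toLinearMap

end Pullback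

end Forms

/-! ### Hodge Laplacian on 1-forms of a Riemannian manifold -/

section Hodge

variable {d : ℕ} {M : Type*} [TopologicalSpace M] [ChartedSpace (EuclideanSpace ℝ (Fin d)) M]

variable (d M) in
/-- Smooth Riemannian metrics on `M`. -/
abbrev RMetric [IsManifold (𝓡 d) ∞ M] : Type _ :=
  Bundle.ContMDiffRiemannianMetric (𝓡 d) ∞ (EuclideanSpace ℝ (Fin d))
    (fun x : M => TangentSpace (𝓡 d) x)

/-- The `i`-th coordinate vector field of the preferred chart at `x`, at the point with
coordinates `y`. -/
noncomputable def coordVec (x : M) (i : Fin d) (y : EuclideanSpace ℝ (Fin d)) :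
    TangentSpace (𝓡 d) ((extChartAt (𝓡 d) x).symm y) :=
  chartSymmDeriv x y (EuclideanSpace.single i (1 : ℝ))

/-- The matrix `(g_ij)` of the metric in the preferred chart at `x`. -/
noncomputable def gram [IsManifold (𝓡 d) ∞ M] (g : RMetric d M) (x : M)
    (y : EuclideanSpace ℝ (Fin d)) : Matrix (Fin d) (Fin d) ℝ :=
  Matrix.of fun i j => g.inner _ (coordVec x i y) (coordVec x j y)

/-- The Riemannian volume density `√det(g_ij)`. -/
noncomputable def volDensity [IsManifold (𝓡 d) ∞ M] (g : RMetric d M) (x : M)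
    (y : EuclideanSpace ℝ (Fin d)) : ℝ :=
  Real.sqrt (gram g x y).det

/-- The coordinate expression `|g|^(-1/2) ∑ i, ∂_i (|g|^(1/2) Fⁱ)` at the point `x`. -/
noncomputable def coordDiv [IsManifold (𝓡 d) ∞ M] (g : RMetric d M) (x : M)
    (F : Fin d → EuclideanSpace ℝ (Fin d) → ℝ) : ℝ :=
  (volDensity g x (extChartAt (𝓡 d) x x))⁻¹ *
    ∑ i, fderiv ℝ (fun y => volDensity g x y * F i y) (extChartAt (𝓡 d) x x)
      (EuclideanSpace.single i (1 : ℝ))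

/-- The codifferential of a 1-form: `δθ = -div(θ♯)`. -/
noncomputable def codiffOne [IsManifold (𝓡 d) ∞ M] (g : RMetric d M) (θ : OneForm (𝓡 d) M)
    (x : M) : ℝ :=
  -coordDiv g x fun i y => ∑ j, (gram g x y)⁻¹ i j * θ _ (coordVec x j y)

/-- The codifferential of a 2-form `F`: the 1-form `(δF)_k = -∇ⁱ F_ik`, that is
`(δF)ˡ = -|g|^(-1/2) ∑ i, ∂_i (|g|^(1/2) F^{il})`. -/
noncomputable def codiffTwo [IsManifold (𝓡 d) ∞ M] (g : RMetric d M)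
    (F : (x : M) → (TangentSpace (𝓡 d) x) [⋀^Fin 2]→ₗ[ℝ] ℝ) : OneForm (𝓡 d) M := fun x =>
  ∑ k, (∑ l, gram g x (extChartAt (𝓡 d) x x) k l *
      -coordDiv g x fun i y => ∑ a, ∑ b, (gram g x y)⁻¹ i a * (gram g x y)⁻¹ l b *
        F _ ![coordVec x a y, coordVec x b y]) •
    (EuclideanSpace.proj k : EuclideanSpace ℝ (Fin d) →L[ℝ] ℝ).comp
      (chartDeriv x)

/-- The Hodge Laplacian `Δθ = dδθ + δdθ` of a 1-form. -/
noncomputable def hodgeLaplacian [IsManifold (𝓡 d) ∞ M] (g : RMetric d M)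
    (θ : OneForm (𝓡 d) M) : OneForm (𝓡 d) M := fun x =>
  let dδ : TangentSpace (𝓡 d) x →L[ℝ] ℝ := mfderiv (𝓡 d) 𝓘(ℝ, ℝ) (codiffOne g θ) x
  dδ + codiffTwo g (extD θ) x

/-- The 1-form `θ` is harmonic with respect to the metric `g`. -/
def IsHarmonic [IsManifold (𝓡 d) ∞ M] (g : RMetric d M) (θ : OneForm (𝓡 d) M) : Prop :=
  ∀ x, hodgeLaplacian g θ x = 0

/-- `(η, ξ, φ, g)` is a K-contact structure on the `(2n+1)`-dimensional manifold `M`: a contact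
metric structure whose Reeb vector field `ξ` is a Killing field of `g`. -/
structure IsKContact [IsManifold (𝓡 d) ∞ M] (n : ℕ) (η : OneForm (𝓡 d) M)
    (ξ : (x : M) → TangentSpace (𝓡 d) x)
    (φ : (x : M) → (TangentSpace (𝓡 d) x →ₗ[ℝ] TangentSpace (𝓡 d) x)) (g : RMetric d M) : Prop where
  contact : IsContactForm n η
  smooth_reeb : ContMDiff (𝓡 d) (𝓡 d).tangent ∞
    (fun x => (⟨x, ξ x⟩ : TangentBundle (𝓡 d) M))
  reeb : ∀ x, η x (ξ x) = 1 ∧ ∀ v, extD η x ![ξ x, v] = 0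
  dual : ∀ x v, g.inner x v (ξ x) = η x v
  square : ∀ x v, φ x (φ x v) = -v + η x v • ξ x
  associated : ∀ x u v, extD η x ![u, v] = g.inner x u (φ x v)
  killing : ∀ X Y : (x : M) → TangentSpace (𝓡 d) x,
    ContMDiff (𝓡 d) (𝓡 d).tangent ∞ (fun x => (⟨x, X x⟩ : TangentBundle (𝓡 d) M)) →
    ContMDiff (𝓡 d) (𝓡 d).tangent ∞ (fun x => (⟨x, Y x⟩ : TangentBundle (𝓡 d) M)) →
    ∀ x, (mfderiv (𝓡 d) 𝓘(ℝ, ℝ) (fun y => g.inner y (X y) (Y y)) x (ξ x) : ℝ) =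
      g.inner x (VectorField.mlieBracket (𝓡 d) ξ X x) (Y x) +
        g.inner x (X x) (VectorField.mlieBracket (𝓡 d) ξ Y x)

end Hodge

/-! ### Lie groups -/

section LieGroups

variable {d : ℕ} {G : Type*} [TopologicalSpace G] [ChartedSpace (EuclideanSpace ℝ (Fin d)) G]
  [Group G]

/-- `θ` is invariant under all right translations of `G`. -/
def RightInvariant (θ : OneForm (𝓡 d) G) : Prop :=
  ∀ a : G, pullForm (𝓡 d) (𝓡 d) (fun x => x * a) θ = θ

/-- The metric `g` is invariant under all right translations of `G`. -/
def RightInvariantMetric [LieGroup (𝓡 d) ∞ G] (g : RMetric d G) : Prop :=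
  ∀ (a x : G) (u v : TangentSpace (𝓡 d) x),
    g.inner (x * a) (mfderiv (𝓡 d) (𝓡 d) (fun y => y * a) x u)
      (mfderiv (𝓡 d) (𝓡 d) (fun y => y * a) x v) = g.inner x u v

/-- `G` is a K-contact Lie group of dimension `2n+1`: it carries a K-contact structure whose contact
form and metric (hence also the Reeb field and `φ`) are right-invariant. -/
def KContactLieGroup (n : ℕ) (G : Type*) [TopologicalSpace G]
    [ChartedSpace (EuclideanSpace ℝ (Fin (2 * n + 1))) G] [Group G]
    [LieGroup (𝓡 (2 * n + 1)) ∞ G] : Prop :=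
  ∃ (η : OneForm (𝓡 (2 * n + 1)) G) (ξ : (x : G) → TangentSpace (𝓡 (2 * n + 1)) x)
    (φ : (x : G) → (TangentSpace (𝓡 (2 * n + 1)) x →ₗ[ℝ] TangentSpace (𝓡 (2 * n + 1)) x))
    (g : RMetric (2 * n + 1) G),
    IsKContact n η ξ φ g ∧ RightInvariant η ∧ RightInvariantMetric g

end LieGroups

/-! On one factor let η be the invariant contact form, ξ its Reeb field and θ the closed invariant
form. Right translations preserve η, hence ξ, so θ(ξ) is constant (`RightInvariant.apply_reeb_eq`).
Choose c = ±1 with c θ(ξ) ≥ 0 and put α = cη, whose Reeb field is cξ. Since dθ = 0, and a top-degree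
form killed by a nonzero vector vanishes, (θ + tα) ∧ (d(θ + tα))ⁿ = tⁿ (θ(cξ) + t) α ∧ (dα)ⁿ, which
is nowhere zero for t > 0 (`contactWedge_eq_smul_of_reeb`, `IsContactForm.add_closed`). So θ + tα is
contact for every t > 0.

The two families are then pulled back to the product. Naturality of d (`extD_pullForm`) carries
class and characteristic distribution through the projections, and the volume condition holds
because the two top-degree forms multiply on split frames (`wedge_fst_snd_apply`). A contact form
has zero characteristic distribution, so the pullbacks have the kernels of the two projections,
which are complementary and tangent to the fibres. -/

/-! ### Smoothness and exterior derivative of 1-forms in charts; naturality under pullback. -/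

section SmoothForms

open Bundle Filter Topology

variable {E : Type*} [NormedAddCommGroup E] [NormedSpace ℝ E] {H : Type*} [TopologicalSpace H]
  {I : ModelWithCorners ℝ E H} [I.Boundaryless]
  {M : Type*} [TopologicalSpace M] [ChartedSpace H M] [IsManifold I ∞ M]
  {E' : Type*} [NormedAddCommGroup E'] [NormedSpace ℝ E'] {H' : Type*} [TopologicalSpace H']
  {I' : ModelWithCorners ℝ E' H'} [I'.Boundaryless]
  {N : Type*} [TopologicalSpace N] [ChartedSpace H' N] [IsManifold I' ∞ N]

omit [I.Boundaryless] [IsManifold I ∞ M] in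
theorem chartForm_extChartAt (θ : OneForm I M) {x y : M} (hy : y ∈ (extChartAt I x).source) :
    chartForm θ x (extChartAt I x y) =
      (show E →L[ℝ] ℝ from θ y).comp
        (mfderiv 𝓘(ℝ, E) I (extChartAt I x).symm (extChartAt I x y) : E →L[ℝ] E) := by
  -- All tangent spaces unfold to `E`, so covectors at propositionally equal points can be compared
  -- directly.
  have key : ∀ z, z = y → (θ z : E →L[ℝ] ℝ) = θ y := by rintro _ rfl; rfl
  exact congrArg (fun L : E →L[ℝ] ℝ => L.comp
    (mfderiv 𝓘(ℝ, E) I (extChartAt I x).symm (extChartAt I x y) : E →L[ℝ] E))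
    (key _ ((extChartAt I x).left_inv hy))

theorem chartForm_comp_mfderiv_extChartAt (θ : OneForm I M) {x y : M}
    (hy : y ∈ (extChartAt I x).source) :
    (chartForm θ x (extChartAt I x y)).comp
      (mfderiv I 𝓘(ℝ, E) (extChartAt I x) y : TangentSpace I y →L[ℝ] E) = θ y := by
  have : IsManifold I 1 M := IsManifold.of_le (n := ∞) (by simp)
  rw [chartForm_extChartAt θ hy]
  have h := mfderivWithin_extChartAt_symm_comp_mfderiv_extChartAt (I := I)
    ((extChartAt I x).map_source hy)
  rw [I.range_eq_univ, mfderivWithin_univ] at h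
  have key : ∀ z, z = y → ((mfderiv 𝓘(ℝ, E) I (extChartAt I x).symm (extChartAt I x y) :
      E →L[ℝ] E).comp (mfderiv I 𝓘(ℝ, E) (extChartAt I x) z : E →L[ℝ] E) =
        ContinuousLinearMap.id ℝ E) →
      (mfderiv 𝓘(ℝ, E) I (extChartAt I x).symm (extChartAt I x y) :
      E →L[ℝ] E).comp (mfderiv I 𝓘(ℝ, E) (extChartAt I x) y : E →L[ℝ] E) =
        ContinuousLinearMap.id ℝ E := by
    rintro _ rfl h; exact h
  have h2 := key _ ((extChartAt I x).left_inv hy) h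
  ext v
  exact congrArg (θ y) (congrArg (fun L : E →L[ℝ] E => L v) h2)

/-- The tangent bundle is trivialized by the derivative of the inverse chart; this is the bridge
from bundle smoothness to calculus in `E`. -/
theorem inCoordinates_eq_chartForm (θ : OneForm I M) {x y : M} (hy : y ∈ (chartAt H x).source) :
    ContinuousLinearMap.inCoordinates E (TangentSpace I) ℝ (Bundle.Trivial M ℝ) x y x y (θ y) =
      chartForm θ x (extChartAt I x y) := by
  have : IsManifold I 1 M := IsManifold.of_le (n := ∞) (by simp)
  have h1 := TangentBundle.symmL_trivializationAt (I := I) hy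
  rw [I.range_eq_univ, mfderivWithin_univ] at h1
  rw [chartForm_extChartAt θ (by simpa using hy)]
  unfold ContinuousLinearMap.inCoordinates
  rw [h1]
  ext v
  simp
  rfl

theorem smoothForm_iff_chartForm {θ : OneForm I M} :
    SmoothForm θ ↔ ∀ x, ContDiffAt ℝ ∞ (chartForm θ x) (extChartAt I x x) := by
  refine forall_congr' fun x => ?_
  rw [contMDiffAt_hom_bundle]
  have h1 : ∀ᶠ y in 𝓝 x, ContinuousLinearMap.inCoordinates E (TangentSpace I) ℝ
      (Bundle.Trivial M ℝ) x y x y (θ y) = chartForm θ x (extChartAt I x y) := by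
    filter_upwards [chart_source_mem_nhds H x] with y hy using inCoordinates_eq_chartForm θ hy
  constructor
  · rintro ⟨-, h⟩
    have h2 := h.congr_of_eventuallyEq (EventuallyEq.symm h1)
    have h3 := (contMDiffOn_extChartAt_symm (I := I) (n := ∞) x).contMDiffAt
      (extChartAt_target_mem_nhds x)
    have h4 := ContMDiffAt.comp_of_eq h2 h3 (extChartAt_to_inv x)
    rw [contMDiffAt_iff_contDiffAt] at h4
    refine h4.congr_of_eventuallyEq ?_
    filter_upwards [extChartAt_target_mem_nhds (I := I) x] with y hy
    rw [Function.comp_apply, (extChartAt I x).right_inv hy]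
  · intro h
    refine ⟨contMDiffAt_id, ?_⟩
    refine ContMDiffAt.congr_of_eventuallyEq ?_ h1
    exact h.contMDiffAt.comp x contMDiffAt_extChartAt

omit [I'.Boundaryless] [IsManifold I' ∞ N] in
theorem contDiffAt_chart_comp {f : M → N} (hf : ContMDiff I I' ∞ f) (x : M) :
    ContDiffAt ℝ ∞ (fun z => extChartAt I' (f x) (f ((extChartAt I x).symm z)))
      (extChartAt I x x) := by
  have h3 := (contMDiffOn_extChartAt_symm (I := I) (n := ∞) x).contMDiffAt
      (extChartAt_target_mem_nhds x)
  have h4 : ContMDiffAt I I' ∞ f ((extChartAt I x).symm (extChartAt I x x)) := hf _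
  have h5 := h4.comp _ h3
  have h6 := ContMDiffAt.comp_of_eq (contMDiffAt_extChartAt (I := I') (n := ∞) (x := f x)) h5
    (by simp)
  exact h6.contDiffAt

/-- The chain rule through inverse chart, `f` and target chart. It holds only near the centre, where
`f` lands in the domain of the target chart. -/
theorem chartForm_pullForm (θ : OneForm I' N) {f : M → N} (hf : ContMDiff I I' ∞ f) (x : M) :
    ∀ᶠ y in 𝓝 (extChartAt I x x), chartForm (pullForm I I' f θ) x y =
      (chartForm θ (f x) (extChartAt I' (f x) (f ((extChartAt I x).symm y)))).comp
        (fderiv ℝ (fun z => extChartAt I' (f x) (f ((extChartAt I x).symm z))) y) := by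
  have h3 := (contMDiffOn_extChartAt_symm (I := I) (n := ∞) x).contMDiffAt
      (extChartAt_target_mem_nhds x)
  have hc : ContinuousAt (fun z => f ((extChartAt I x).symm z)) (extChartAt I x x) :=
    hf.continuous.continuousAt.comp h3.continuousAt
  filter_upwards [eventually_mem_nhds_iff.2 (extChartAt_target_mem_nhds (I := I) x),
    hc.preimage_mem_nhds (by
      rw [extChartAt_to_inv]
      exact extChartAt_source_mem_nhds (I := I') (f x))] with y hy hy'
  have hy1 : f ((extChartAt I x).symm y) ∈ (extChartAt I' (f x)).source := hy'
  have d1 : MDifferentiableAt 𝓘(ℝ, E) I (extChartAt I x).symm y :=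
    ((contMDiffOn_extChartAt_symm (I := I) (n := ∞) x).contMDiffAt hy).mdifferentiableAt (by simp)
  have d2 : MDifferentiableAt I I' f ((extChartAt I x).symm y) := hf.mdifferentiableAt (by simp)
  have d3 : MDifferentiableAt I' 𝓘(ℝ, E') (extChartAt I' (f x)) (f ((extChartAt I x).symm y)) :=
    mdifferentiableAt_extChartAt (by simpa using hy1)
  have h5 := (d3.hasMFDerivAt.comp (f := fun z => f ((extChartAt I x).symm z)) y
    (d2.hasMFDerivAt.comp y d1.hasMFDerivAt)).mfderiv
  rw [← mfderiv_eq_fderiv]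
  have h6 := chartForm_comp_mfderiv_extChartAt θ hy1
  ext v
  have h7 := congrArg (fun L : E →L[ℝ] E' => L v) h5
  have h8 := congrArg (fun L : E' →L[ℝ] ℝ => L (mfderiv I I' f ((extChartAt I x).symm y)
    (mfderiv 𝓘(ℝ, E) I (extChartAt I x).symm y v))) h6
  exact h8.symm.trans (congrArg (chartForm θ (f x) (extChartAt I' (f x)
    (f ((extChartAt I x).symm y)))) h7.symm)

theorem SmoothForm.pullForm {θ : OneForm I' N} (hθ : SmoothForm θ) {f : M → N}
    (hf : ContMDiff I I' ∞ f) : SmoothForm (pullForm I I' f θ) := by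
  rw [smoothForm_iff_chartForm] at hθ ⊢
  intro x
  refine ContDiffAt.congr_of_eventuallyEq ?_ (chartForm_pullForm θ hf x)
  have hF := contDiffAt_chart_comp hf x
  refine ContDiffAt.clm_comp ?_ (hF.fderiv_right (by simp))
  refine ContDiffAt.comp (g := chartForm θ (f x)) _ ?_ hF
  simpa using hθ (f x)

theorem SmoothForm.differentiableAt_chartForm {θ : OneForm I M} (hθ : SmoothForm θ) (x : M) :
    DifferentiableAt ℝ (chartForm θ x) (extChartAt I x x) :=
  (smoothForm_iff_chartForm.1 hθ x).differentiableAt (by simp)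

theorem DifferentiableAt.ofSubsingleton_form {f : E → E →L[ℝ] ℝ} {y : E}
    (hf : DifferentiableAt ℝ f y) : DifferentiableAt ℝ (fun y =>
      ContinuousAlternatingMap.ofSubsingleton ℝ E ℝ (0 : Fin 1) (f y)) y := by
  exact (ContinuousAlternatingMap.ofSubsingletonLIE (𝕜 := ℝ) (E := E) (F := ℝ)
    (0 : Fin 1)).toContinuousLinearEquiv.differentiableAt.comp y hf

/-- Reduces to `extDeriv_pullback` for the chart expression of `f`; the chain rule then trades the
derivative of that expression for the derivative of `f` (`h2`). -/
theorem extD_pullForm {θ : OneForm I' N} (hθ : SmoothForm θ) {f : M → N}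
    (hf : ContMDiff I I' ∞ f) (x : M) :
    extD (pullForm I I' f θ) x =
      (extD θ (f x)).compLinearMap (mfderiv I I' f x).toLinearMap := by
  have : IsManifold I 1 M := IsManifold.of_le (n := ∞) (by simp)
  have hF := contDiffAt_chart_comp hf x
  have hθ' := (hθ.differentiableAt_chartForm (f x)).ofSubsingleton_form
  have e1 : (fun y => ContinuousAlternatingMap.ofSubsingleton ℝ E ℝ (0 : Fin 1)
      (chartForm (_root_.pullForm I I' f θ) x y)) =ᶠ[𝓝 (extChartAt I x x)]
      fun y => (ContinuousAlternatingMap.ofSubsingleton ℝ E' ℝ (0 : Fin 1) (chartForm θ (f x)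
        (extChartAt I' (f x) (f ((extChartAt I x).symm y))))).compContinuousLinearMap
        (fderiv ℝ (fun z => extChartAt I' (f x) (f ((extChartAt I x).symm z))) y) := by
    filter_upwards [chartForm_pullForm θ hf x] with y hy
    rw [hy]
    ext v
    rfl
  unfold extD
  rw [e1.extDeriv_eq]
  have hpt : extChartAt I' (f x) (f ((extChartAt I x).symm (extChartAt I x x))) =
      extChartAt I' (f x) (f x) := by simp
  have h1 := extDeriv_pullback
    (f := fun z => extChartAt I' (f x) (f ((extChartAt I x).symm z))) (by rw [hpt]; exact hθ') hF
    (by rw [minSmoothness_of_isRCLikeNormedField]; exact WithTop.coe_le_coe.2 le_top)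
  rw [h1, hpt]
  have d1 : MDifferentiableAt I 𝓘(ℝ, E) (extChartAt I x) x := mdifferentiableAt_extChartAt (by simp)
  have d2 : MDifferentiableAt I I' f x := hf.mdifferentiableAt (by simp)
  have d3 : MDifferentiableAt I' 𝓘(ℝ, E') (extChartAt I' (f x)) (f x) :=
    mdifferentiableAt_extChartAt (by simp)
  have dF := (hF.differentiableAt (by simp)).hasFDerivAt.hasMFDerivAt
  have e2 : (fun z => extChartAt I' (f x) (f z)) =ᶠ[𝓝 x]
      (fun z => extChartAt I' (f x) (f ((extChartAt I x).symm z))) ∘ extChartAt I x := by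
    filter_upwards [extChartAt_source_mem_nhds (I := I) x] with z hz
    simp only [Function.comp_apply, (extChartAt I x).left_inv hz]
  have h2 := hasMFDerivAt_unique (d3.hasMFDerivAt.comp x d2.hasMFDerivAt)
    ((dF.comp x d1.hasMFDerivAt).congr_of_eventuallyEq e2)
  ext v
  refine congrArg (extDeriv _ _) (funext fun i => ?_)
  exact (congrArg (fun L : TangentSpace I x →L[ℝ] E' => L (v i)) h2).symm

theorem SmoothForm.add {θ κ' : OneForm I M} (hθ : SmoothForm θ) (hκ : SmoothForm κ') :
    SmoothForm (θ + κ') := by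
  rw [smoothForm_iff_chartForm] at *
  exact fun x => (hθ x).add (hκ x)

theorem SmoothForm.const_smul {θ : OneForm I M} (hθ : SmoothForm θ) (c : ℝ) :
    SmoothForm (c • θ) := by
  rw [smoothForm_iff_chartForm] at *
  exact fun x => (hθ x).const_smul c

theorem extD_add {θ κ' : OneForm I M} (hθ : SmoothForm θ) (hκ : SmoothForm κ') (x : M) :
    extD (θ + κ') x = extD θ x + extD κ' x := by
  unfold extD
  have h := extDeriv_add (hθ.differentiableAt_chartForm x).ofSubsingleton_form
    (hκ.differentiableAt_chartForm x).ofSubsingleton_form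
  ext v
  exact congrArg (fun L : E [⋀^Fin 2]→L[ℝ] ℝ => L fun i => chartDeriv x (v i)) h

omit [I.Boundaryless] [IsManifold I ∞ M] in
theorem extD_smul (c : ℝ) (θ : OneForm I M) (x : M) :
    extD (c • θ) x = c • extD θ x := by
  unfold extD
  have h := extDeriv_smul (x := extChartAt I x x) c (fun y : E =>
      ContinuousAlternatingMap.ofSubsingleton ℝ E ℝ (0 : Fin 1) (chartForm θ x y))
  ext v
  exact congrArg (fun L : E [⋀^Fin 2]→L[ℝ] ℝ => L fun i => chartDeriv x (v i)) h

end SmoothForms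

/-! ### Wedge algebra and top-degree forms. -/

section WedgeLemmas

open Equiv

variable {V : Type*} [AddCommGroup V] [Module ℝ V] {W : Type*} [AddCommGroup W] [Module ℝ W]
  {p q : ℕ}

/-- The wedge product as a normalized sum over all permutations. -/
theorem factorial_mul_wedge_apply (a : V [⋀^Fin p]→ₗ[ℝ] ℝ) (b : V [⋀^Fin q]→ₗ[ℝ] ℝ)
    (v : Fin (p + q) → V) :
    ((p.factorial * q.factorial : ℕ) : ℝ) * wedge a b v =
      ∑ σ : Perm (Fin p ⊕ Fin q), (Perm.sign σ : ℝ) *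
        ((a fun i => v (finSumFinEquiv (σ (Sum.inl i)))) *
          b fun i => v (finSumFinEquiv (σ (Sum.inr i)))) := by
  have h := MultilinearMap.domCoprod_alternization_eq a b
  have h1 := congrArg (fun L => LinearMap.mul' ℝ ℝ (L fun i => v (finSumFinEquiv i))) h
  simp only [Fintype.card_fin, AlternatingMap.smul_apply, map_nsmul] at h1
  rw [nsmul_eq_mul] at h1
  refine Eq.trans ?_ (h1.symm.trans ?_)
  · rfl
  · rw [MultilinearMap.alternatization_apply, map_sum]
    refine Finset.sum_congr rfl fun σ _ => ?_
    simp only [MultilinearMap.domDomCongr_apply, MultilinearMap.domCoprod_apply]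
    rcases Int.units_eq_one_or (Perm.sign σ) with h | h <;> simp [h]

/-- Cancelling p! q! lets wedge identities be checked on sums over all permutations, without
handling shuffle classes. -/
theorem wedge_apply_eq_of_sum_eq {a : V [⋀^Fin p]→ₗ[ℝ] ℝ} {b : V [⋀^Fin q]→ₗ[ℝ] ℝ}
    {v : Fin (p + q) → V} {r : ℝ}
    (h : ∑ σ : Perm (Fin p ⊕ Fin q), (Perm.sign σ : ℝ) *
        ((a fun i => v (finSumFinEquiv (σ (Sum.inl i)))) *
          b fun i => v (finSumFinEquiv (σ (Sum.inr i)))) =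
      ((p.factorial * q.factorial : ℕ) : ℝ) * r) : wedge a b v = r := by
  have h0 : ((p.factorial * q.factorial : ℕ) : ℝ) ≠ 0 := by positivity
  exact mul_left_cancel₀ h0 ((factorial_mul_wedge_apply a b v).trans h)

theorem wedge_add_left (a a' : V [⋀^Fin p]→ₗ[ℝ] ℝ) (b : V [⋀^Fin q]→ₗ[ℝ] ℝ) :
    wedge (a + a') b = wedge a b + wedge a' b := by
  ext v
  apply wedge_apply_eq_of_sum_eq
  rw [AlternatingMap.add_apply, mul_add, factorial_mul_wedge_apply, factorial_mul_wedge_apply,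
    ← Finset.sum_add_distrib]
  exact Finset.sum_congr rfl fun σ _ => by rw [AlternatingMap.add_apply]; ring

theorem wedge_smul_left (c : ℝ) (a : V [⋀^Fin p]→ₗ[ℝ] ℝ) (b : V [⋀^Fin q]→ₗ[ℝ] ℝ) :
    wedge (c • a) b = c • wedge a b := by
  ext v
  apply wedge_apply_eq_of_sum_eq
  rw [AlternatingMap.smul_apply, smul_eq_mul, mul_left_comm, factorial_mul_wedge_apply,
    Finset.mul_sum]
  exact Finset.sum_congr rfl fun σ _ => by rw [AlternatingMap.smul_apply, smul_eq_mul]; ring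

theorem wedge_smul_right (c : ℝ) (a : V [⋀^Fin p]→ₗ[ℝ] ℝ) (b : V [⋀^Fin q]→ₗ[ℝ] ℝ) :
    wedge a (c • b) = c • wedge a b := by
  ext v
  apply wedge_apply_eq_of_sum_eq
  rw [AlternatingMap.smul_apply, smul_eq_mul, mul_left_comm, factorial_mul_wedge_apply,
    Finset.mul_sum]
  exact Finset.sum_congr rfl fun σ _ => by rw [AlternatingMap.smul_apply, smul_eq_mul]; ring

theorem wedge_compLinearMap (f : W →ₗ[ℝ] V) (a : V [⋀^Fin p]→ₗ[ℝ] ℝ) (b : V [⋀^Fin q]→ₗ[ℝ] ℝ) :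
    wedge (a.compLinearMap f) (b.compLinearMap f) = (wedge a b).compLinearMap f := by
  ext v
  apply wedge_apply_eq_of_sum_eq
  rw [AlternatingMap.compLinearMap_apply, factorial_mul_wedge_apply]
  rfl

/-- A wedge product vanishes when one argument is annihilated by both factors. -/
theorem wedge_apply_eq_zero {a : V [⋀^Fin p]→ₗ[ℝ] ℝ} {b : V [⋀^Fin q]→ₗ[ℝ] ℝ} {u : V}
    (ha : ∀ v i, v i = u → a v = 0) (hb : ∀ v i, v i = u → b v = 0) (v : Fin (p + q) → V)
    (i : Fin (p + q)) (hi : v i = u) : wedge a b v = 0 := by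
  apply wedge_apply_eq_of_sum_eq
  rw [mul_zero]
  refine Finset.sum_eq_zero fun σ _ => ?_
  -- In the term of `σ`, the vector `u` occupies the slot σ⁻¹(i), which belongs to one of the two
  -- factors.
  have hj : v (finSumFinEquiv (σ (σ.symm (finSumFinEquiv.symm i)))) = u := by simpa using hi
  rcases h : σ.symm (finSumFinEquiv.symm i) with j | j <;> rw [h] at hj
  · rw [ha _ j hj, zero_mul, mul_zero]
  · rw [hb _ j hj, mul_zero, mul_zero]

/-- The wedge product of forms pulled back from the factors of a product, evaluated on vectors
tangent to the factors. -/
theorem wedge_fst_snd_apply (a : V [⋀^Fin p]→ₗ[ℝ] ℝ) (b : W [⋀^Fin q]→ₗ[ℝ] ℝ)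
    (v : Fin p → V) (w : Fin q → W) :
    wedge (a.compLinearMap (LinearMap.fst ℝ V W)) (b.compLinearMap (LinearMap.snd ℝ V W))
      (fun i => Sum.elim (fun j => (v j, 0)) (fun j => (0, w j)) (finSumFinEquiv.symm i)) =
      a v * b w := by
  apply wedge_apply_eq_of_sum_eq
  -- Only the p! q! block-preserving permutations contribute. For each, the signs cancel against
  -- those of `a` and `b`, and the count matches the normalization.
  rw [← Finset.sum_subset (Finset.subset_univ
    (Finset.univ.image (Perm.sumCongrHom (Fin p) (Fin q)))),
    Finset.sum_image (Perm.sumCongrHom_injective.injOn)]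
  · rw [Finset.sum_congr rfl (g := fun _ => a v * b w)]
    · simp [Fintype.card_perm]
    · rintro ⟨σ, τ⟩ -
      have h1 := a.map_perm v σ
      have h2 := b.map_perm w τ
      simp only [Function.comp_def] at h1 h2
      simp only [Perm.sumCongrHom_apply, Perm.sumCongr_apply, Sum.map_inl, Sum.map_inr,
        Equiv.symm_apply_apply, AlternatingMap.compLinearMap_apply, Sum.elim_inl, Sum.elim_inr,
        LinearMap.fst_apply, LinearMap.snd_apply, Perm.sign_sumCongr, h1, h2]
      rcases Int.units_eq_one_or (Perm.sign σ) with h | h <;>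
      rcases Int.units_eq_one_or (Perm.sign τ) with h' | h' <;> simp [h, h']
  · intro σ _ hσ
    -- A permutation that mixes the blocks feeds `a` a vector with zero first component.
    suffices h : ∃ i j, σ (Sum.inl i) = Sum.inr j by
      obtain ⟨i, j, hij⟩ := h
      rw [AlternatingMap.compLinearMap_apply a, a.map_coord_zero i (by simp [hij]), zero_mul,
        mul_zero]
    by_contra! h
    refine hσ ?_
    obtain ⟨τ, hτ⟩ := Perm.mem_sumCongrHom_range_of_perm_mapsTo_inl (σ := σ) (by
      rintro _ ⟨i, rfl⟩
      rcases h' : σ (Sum.inl i) with j | j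
      · exact ⟨j, rfl⟩
      · exact absurd h' (h i j))
    exact Finset.mem_image.2 ⟨τ, Finset.mem_univ _, hτ⟩

theorem wedgePow_smul (c : ℝ) (θ : V [⋀^Fin 2]→ₗ[ℝ] ℝ) (k : ℕ) :
    wedgePow (c • θ) k = c ^ k • wedgePow θ k := by
  induction k with
  | zero => simp [wedgePow]
  | succ k ih =>
    rw [wedgePow, wedgePow, ih, wedge_smul_left, wedge_smul_right, smul_smul, pow_succ]

theorem wedgePow_compLinearMap (f : W →ₗ[ℝ] V) (θ : V [⋀^Fin 2]→ₗ[ℝ] ℝ) (k : ℕ) :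
    wedgePow (θ.compLinearMap f) k = (wedgePow θ k).compLinearMap f := by
  induction k with
  | zero => rfl
  | succ k ih => rw [wedgePow, wedgePow, ih, wedge_compLinearMap]

theorem twoForm_sub_apply (θ : V [⋀^Fin 2]→ₗ[ℝ] ℝ) (u u' w : V) :
    θ ![u - u', w] = θ ![u, w] - θ ![u', w] := by
  have e : ∀ c, Function.update ![u, w] 0 c = ![c, w] := by intro c; ext i; fin_cases i <;> rfl
  simpa only [e] using θ.map_update_sub ![u, w] 0 u u'

theorem twoForm_smul_apply (θ : V [⋀^Fin 2]→ₗ[ℝ] ℝ) (c : ℝ) (u w : V) :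
    θ ![c • u, w] = c * θ ![u, w] := by
  have e : ∀ c, Function.update ![u, w] 0 c = ![c, w] := by intro c; ext i; fin_cases i <;> rfl
  simpa only [e, smul_eq_mul] using θ.map_update_smul ![u, w] 0 c u

theorem twoForm_apply_eq_zero {θ : V [⋀^Fin 2]→ₗ[ℝ] ℝ} {u : V} (hu : ∀ w, θ ![u, w] = 0)
    (v : Fin 2 → V) (i : Fin 2) (hi : v i = u) : θ v = 0 := by
  fin_cases i
  · have : v = ![u, v 1] := by ext j; fin_cases j <;> simp_all
    rw [this, hu]
  · have h := θ.map_swap v (i := 0) (j := 1) (by decide)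
    have : v ∘ Equiv.swap 0 1 = ![u, v 0] := by ext j; fin_cases j <;> simp_all
    rw [this, hu] at h
    linarith

theorem wedgePow_apply_eq_zero {θ : V [⋀^Fin 2]→ₗ[ℝ] ℝ} {u : V} (hu : ∀ w, θ ![u, w] = 0)
    (k : ℕ) (v : Fin (2 * k) → V) (i : Fin (2 * k)) (hi : v i = u) : wedgePow θ k v = 0 := by
  induction k with
  | zero => exact i.elim0
  | succ k ih => exact wedge_apply_eq_zero ih (twoForm_apply_eq_zero hu) v i hi

theorem contactWedge_add_left (k : ℕ) (a a' : V →ₗ[ℝ] ℝ) (θ : V [⋀^Fin 2]→ₗ[ℝ] ℝ) :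
    contactWedge k (a + a') θ = contactWedge k a θ + contactWedge k a' θ := by
  rw [contactWedge, contactWedge, contactWedge, ← wedge_add_left]
  rfl

theorem contactWedge_smul_left (k : ℕ) (c : ℝ) (a : V →ₗ[ℝ] ℝ) (θ : V [⋀^Fin 2]→ₗ[ℝ] ℝ) :
    contactWedge k (c • a) θ = c • contactWedge k a θ := by
  rw [contactWedge, contactWedge, ← wedge_smul_left]
  rfl

theorem contactWedge_smul_right (k : ℕ) (c : ℝ) (a : V →ₗ[ℝ] ℝ) (θ : V [⋀^Fin 2]→ₗ[ℝ] ℝ) :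
    contactWedge k a (c • θ) = c ^ k • contactWedge k a θ := by
  rw [contactWedge, contactWedge, wedgePow_smul, wedge_smul_right]

theorem contactWedge_compLinearMap (k : ℕ) (f : W →ₗ[ℝ] V) (a : V →ₗ[ℝ] ℝ)
    (θ : V [⋀^Fin 2]→ₗ[ℝ] ℝ) :
    contactWedge k (a ∘ₗ f) (θ.compLinearMap f) = (contactWedge k a θ).compLinearMap f := by
  rw [contactWedge, contactWedge, wedgePow_compLinearMap, ← wedge_compLinearMap]
  rfl

/-- A form of top degree annihilated by a nonzero vector vanishes. -/
theorem alternatingMap_eq_zero_of_annihilated [FiniteDimensional ℝ V] {N : ℕ}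
    (hN : Module.finrank ℝ V = N) (κ : V [⋀^Fin N]→ₗ[ℝ] ℝ) {u : V} (hu : u ≠ 0)
    (h : ∀ v i, v i = u → κ v = 0) : κ = 0 := by
  -- Extend `u` to a basis: in top degree an injective tuple of basis vectors exhausts the basis, so
  -- it contains `u`.
  have hli : LinearIndepOn ℝ id {u} := LinearIndepOn.singleton hu
  let e := Module.Basis.extend hli
  have : Fintype (hli.extend (Set.subset_univ _)) := FiniteDimensional.fintypeBasisIndex e
  refine Module.Basis.ext_alternating e fun v hv => ?_
  have hc : Fintype.card (Fin N) = Fintype.card (hli.extend (Set.subset_univ _)) := by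
    rw [← Module.finrank_eq_card_basis e, hN, Fintype.card_fin]
  obtain ⟨i, hi⟩ := ((Fintype.bijective_iff_injective_and_card v).2 ⟨hv, hc⟩).2
    ⟨u, hli.subset_extend _ rfl⟩
  exact h _ i (by simp [hi, e])

theorem alternatingMap_eq_zero_of_finrank_lt [FiniteDimensional ℝ V] {N : ℕ}
    (hN : Module.finrank ℝ V < N) (κ : V [⋀^Fin N]→ₗ[ℝ] ℝ) : κ = 0 := by
  ext v
  refine κ.map_linearDependent v fun h => ?_
  have := h.fintype_card_le_finrank
  simp at this
  omega

/-- A nonzero vector annihilated by `a` and `θ` makes `a ∧ θ ∧ ⋯ ∧ θ` vanish in top degree. -/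
theorem contactWedge_eq_zero_of_annihilated {n : ℕ}
    (hn : Module.finrank ℝ V = 2 * n + 1) {a : V →ₗ[ℝ] ℝ} {θ : V [⋀^Fin 2]→ₗ[ℝ] ℝ} {u : V}
    (hu : u ≠ 0) (ha : a u = 0) (hθ : ∀ w, θ ![u, w] = 0) : contactWedge n a θ = 0 := by
  have : FiniteDimensional ℝ V := Module.finite_of_finrank_pos (by omega)
  refine alternatingMap_eq_zero_of_annihilated (by omega) _ hu
    (wedge_apply_eq_zero (fun v i hi => ?_) (wedgePow_apply_eq_zero hθ n))
  rw [linForm, AlternatingMap.ofSubsingleton_apply_apply, ← ha, ← hi, Subsingleton.elim i 0]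

theorem wedgePow_succ_eq_zero {n : ℕ} (hn : Module.finrank ℝ V = 2 * n + 1)
    (θ : V [⋀^Fin 2]→ₗ[ℝ] ℝ) : wedgePow θ (n + 1) = 0 := by
  have : FiniteDimensional ℝ V := Module.finite_of_finrank_pos (by omega)
  exact alternatingMap_eq_zero_of_finrank_lt (by omega) _

/-- If `u` is the Reeb vector of `(a, θ)` then `c ∧ θⁿ = c(u) a ∧ θⁿ` in top degree. -/
theorem contactWedge_eq_smul_of_reeb {n : ℕ}
    (hn : Module.finrank ℝ V = 2 * n + 1) {a : V →ₗ[ℝ] ℝ} {θ : V [⋀^Fin 2]→ₗ[ℝ] ℝ} {u : V}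
    (ha : a u = 1) (hθ : ∀ w, θ ![u, w] = 0) (c : V →ₗ[ℝ] ℝ) :
    contactWedge n c θ = c u • contactWedge n a θ := by
  have hu : u ≠ 0 := by rintro rfl; simp at ha
  -- The form c − c(u)a kills `u`, because a(u) = 1, and `θ` kills it as well.
  have h : contactWedge n (c + (-(c u)) • a) θ = 0 :=
    contactWedge_eq_zero_of_annihilated hn hu (by simp [ha]) hθ
  rw [contactWedge_add_left, contactWedge_smul_left] at h
  rw [eq_neg_of_add_eq_zero_left h]
  ext v
  simp

end WedgeLemmas

/-! ### Contact forms, their Reeb fields and right-invariance. -/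

section ContactForms

variable {d n : ℕ} {G : Type*} [TopologicalSpace G] [ChartedSpace (EuclideanSpace ℝ (Fin d)) G]

theorem IsContactForm.charDist_eq_bot [IsManifold (𝓡 d) ∞ G] {η : OneForm (𝓡 d) G}
    (hη : IsContactForm n η) (x : G) : charDist η x = ⊥ := by
  rw [Submodule.eq_bot_iff]
  rintro v ⟨h1, h2⟩
  by_contra hv
  exact hη.nondegenerate x (contactWedge_eq_zero_of_annihilated (V := TangentSpace (𝓡 d) x)
    hη.dim hv h1 h2)

theorem IsContactForm.const_smul [IsManifold (𝓡 d) ∞ G] {η : OneForm (𝓡 d) G}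
    (hη : IsContactForm n η) {c : ℝ} (hc : c ≠ 0) : IsContactForm n (c • η) := by
  refine ⟨hη.smooth.const_smul c, hη.dim, fun x => ?_⟩
  have h := contactWedge_smul_left n c (η x).toLinearMap (extD η x)
  rw [classForm, extD_smul, contactWedge_smul_right]
  refine smul_ne_zero (pow_ne_zero _ hc) ?_
  refine fun h0 => smul_ne_zero hc (hη.nondegenerate x) (h.symm.trans h0)

/-- Adding a closed form that is nonnegative on the Reeb field to a positive multiple of a contact
form gives a contact form. -/
theorem IsContactForm.add_closed [IsManifold (𝓡 d) ∞ G] {η θ : OneForm (𝓡 d) G}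
    (hη : IsContactForm n η) (hθ : SmoothForm θ) (hc : ClosedForm θ)
    {ξ : (x : G) → TangentSpace (𝓡 d) x}
    (hξ : ∀ x, η x (ξ x) = 1 ∧ ∀ v, extD η x ![ξ x, v] = 0)
    (hpos : ∀ x, 0 ≤ θ x (ξ x)) {t : ℝ} (ht : 0 < t) : IsContactForm n (θ + t • η) := by
  refine ⟨hθ.add (hη.smooth.const_smul t), hη.dim, fun x => ?_⟩
  -- As d(θ + tη) = t dη, the contact volume of θ + tη is tⁿ(θ(ξ) + t) times that of `η`.
  have h1 := contactWedge_eq_smul_of_reeb (V := TangentSpace (𝓡 d) x) hη.dim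
    (a := (η x).toLinearMap) (hξ x).1 (hξ x).2 (((θ + t • η) x).toLinearMap)
  have h2 : (((θ + t • η) x).toLinearMap) (ξ x) = θ x (ξ x) + t := by
    change θ x (ξ x) + t * η x (ξ x) = _
    rw [(hξ x).1, mul_one]
  rw [classForm, extD_add hθ (hη.smooth.const_smul t), hc x, zero_add, extD_smul,
    contactWedge_smul_right]
  have h3 := h1.trans (congrArg (· • contactWedge n _ (extD η x)) h2)
  refine smul_ne_zero (pow_ne_zero _ ht.ne') fun h0 => ?_
  exact smul_ne_zero (by have := hpos x; positivity) (hη.nondegenerate x) (h3.symm.trans h0)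

variable [Group G] [LieGroup (𝓡 d) ∞ G]

omit [LieGroup (𝓡 d) ∞ G] in
theorem RightInvariant.const_smul {θ : OneForm (𝓡 d) G} (hθ : RightInvariant θ) (c : ℝ) :
    RightInvariant (c • θ) := fun a => by
  ext x v
  exact congrArg (fun L : OneForm (𝓡 d) G => c * L x v) (hθ a)

/-- A right-invariant 1-form is constant along the Reeb field of a right-invariant contact form. -/
theorem RightInvariant.apply_reeb_eq {η θ : OneForm (𝓡 d) G}
    (hη : IsContactForm n η) (hη' : RightInvariant η) (hθ : RightInvariant θ)
    {ξ : (x : G) → TangentSpace (𝓡 d) x}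
    (hξ : ∀ x, η x (ξ x) = 1 ∧ ∀ v, extD η x ![ξ x, v] = 0) (x y : G) :
    θ x (ξ x) = θ y (ξ y) := by
  obtain ⟨a, rfl⟩ : ∃ a, y = x * a := ⟨x⁻¹ * y, by simp⟩
  have hR : ∀ b : G, ContMDiff (𝓡 d) (𝓡 d) ∞ (fun z : G => z * b) := fun b => contMDiff_mul_right
  let T := mfderiv (𝓡 d) (𝓡 d) (fun z : G => z * a) x
  have hθT : ∀ {κ : OneForm (𝓡 d) G}, RightInvariant κ → ∀ v, κ (x * a) (T v) = κ x v :=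
    fun hκ v => congrArg (fun L : OneForm (𝓡 d) G => L x v) (hκ a)
  have hsurj : Function.Surjective T := by
    -- Translation by a⁻¹ gives a left inverse; equality of finite dimensions then gives
    -- surjectivity.
    have hinj : Function.Injective T := by
      have h1 := ((hR a⁻¹).mdifferentiableAt (x := x * a) (by simp)).hasMFDerivAt.comp x
        ((hR a).mdifferentiableAt (x := x) (by simp)).hasMFDerivAt
      have e : (fun z : G => z * a⁻¹) ∘ (fun z => z * a) = id := by ext z; simp
      rw [e] at h1
      have h2 := hasMFDerivAt_unique h1 (hasMFDerivAt_id x)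
      refine Function.LeftInverse.injective
        (g := mfderiv (𝓡 d) (𝓡 d) (fun z : G => z * a⁻¹) (x * a)) fun v => ?_
      exact congrArg (fun L : EuclideanSpace ℝ (Fin d) →L[ℝ] EuclideanSpace ℝ (Fin d) => L v) h2
    exact (LinearMap.injective_iff_surjective
      (f := (show EuclideanSpace ℝ (Fin d) →L[ℝ] EuclideanSpace ℝ (Fin d) from T).toLinearMap)).1 hinj
  have hd : ∀ v w, extD η (x * a) ![T v, T w] = extD η x ![v, w] := fun v w => by
    have h := extD_pullForm hη.smooth (hR a) x
    rw [hη' a] at h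
    rw [h, AlternatingMap.compLinearMap_apply]
    congr 1
    ext i : 1
    fin_cases i <;> rfl
  -- The Reeb vector is unique: the translated one and the one at `x * a` differ by an element of
  -- the zero space ker η ∩ ker dη.
  have hmem : T (ξ x) - ξ (x * a) ∈ charDist η (x * a) := by
    refine ⟨?_, fun w => ?_⟩
    · rw [map_sub, hθT hη', (hξ x).1, (hξ _).1, sub_self]
    · obtain ⟨w, rfl⟩ := hsurj w
      refine (twoForm_sub_apply (V := TangentSpace (𝓡 d) (x * a)) _ _ _ _).trans ?_
      rw [hd, (hξ x).2, (hξ _).2, sub_self]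
  rw [hη.charDist_eq_bot, Submodule.mem_bot, sub_eq_zero] at hmem
  rw [← hmem, hθT hθ]

/-- A K-contact Lie group with a closed right-invariant 1-form `θ` carries a right-invariant 1-form
`α` such that `θ + t α` is a contact form for all `t > 0`. -/
theorem KContactLieGroup.exists_deformation {n : ℕ} {G : Type*} [TopologicalSpace G]
    [ChartedSpace (EuclideanSpace ℝ (Fin (2 * n + 1))) G] [Group G]
    [LieGroup (𝓡 (2 * n + 1)) ∞ G] (hG : KContactLieGroup n G) {θ : OneForm (𝓡 (2 * n + 1)) G}
    (hθ : SmoothForm θ) (hθ' : RightInvariant θ) (hc : ClosedForm θ) :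
    ∃ α : OneForm (𝓡 (2 * n + 1)) G, RightInvariant α ∧ SmoothForm α ∧
      ∀ t : ℝ, 0 < t → IsContactForm n (θ + t • α) := by
  obtain ⟨η, ξ, φ, g, hK, hinv, -⟩ := hG
  -- Since θ(ξ) is constant, its sign at the identity decides `c` = ±1 globally. The relation c² = 1
  -- makes cξ the Reeb field of cη.
  obtain ⟨c, hc1, hc2⟩ : ∃ c : ℝ, c * c = 1 ∧ 0 ≤ c * θ 1 (ξ 1) := by
    rcases le_total 0 (θ 1 (ξ 1)) with h | h
    · exact ⟨1, by simp, by simpa using h⟩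
    · exact ⟨-1, by simp, by simpa using h⟩
  have hK' := hK.contact.const_smul (left_ne_zero_of_mul_eq_one hc1)
  refine ⟨c • η, hinv.const_smul c, hK'.smooth, fun t ht => hK'.add_closed hθ hc
      (ξ := fun x => c • ξ x) (fun x => ⟨?_, fun v => ?_⟩) (fun x => ?_) ht⟩
  · change c * η x (c • ξ x) = 1
    rw [map_smul, (hK.reeb x).1, smul_eq_mul, mul_one, hc1]
  · rw [extD_smul]
    change c * extD η x ![c • ξ x, v] = 0
    rw [twoForm_smul_apply, (hK.reeb x).2, mul_zero, mul_zero]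
  · rw [map_smul, smul_eq_mul, RightInvariant.apply_reeb_eq hK.contact hinv hθ' hK.reeb x 1]
    exact hc2

end ContactForms

/-! ### Pullback of class, characteristic distribution and foliations along submersions. -/

section Submersions

variable {E : Type*} [NormedAddCommGroup E] [NormedSpace ℝ E] {H : Type*} [TopologicalSpace H]
  {I : ModelWithCorners ℝ E H} [I.Boundaryless]
  {M : Type*} [TopologicalSpace M] [ChartedSpace H M] [IsManifold I ∞ M]
  {E' : Type*} [NormedAddCommGroup E'] [NormedSpace ℝ E'] {H' : Type*} [TopologicalSpace H']
  {I' : ModelWithCorners ℝ E' H'} [I'.Boundaryless]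
  {N : Type*} [TopologicalSpace N] [ChartedSpace H' N] [IsManifold I' ∞ N]
  {f : M → N} {θ : OneForm I' N}

theorem classForm_pullForm (hθ : SmoothForm θ) (hf : ContMDiff I I' ∞ f) (k : ℕ) (x : M) :
    classForm k (pullForm I I' f θ) x =
      (classForm k θ (f x)).compLinearMap (mfderiv I I' f x).toLinearMap := by
  rw [classForm, extD_pullForm hθ hf]
  exact contactWedge_compLinearMap k (mfderiv I I' f x).toLinearMap (θ (f x)).toLinearMap _

theorem ClosedForm.pullForm (hc : ClosedForm θ) (hθ : SmoothForm θ) (hf : ContMDiff I I' ∞ f) :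
    ClosedForm (pullForm I I' f θ) := fun x => by
  rw [extD_pullForm hθ hf, hc]
  rfl

/-- Surjectivity makes the pushed-forward test vectors exhaust the tangent space of the target. -/
theorem charDist_pullForm (hθ : SmoothForm θ) (hf : ContMDiff I I' ∞ f)
    (hs : ∀ x, Function.Surjective (mfderiv I I' f x)) :
    charDist (pullForm I I' f θ) = pullDist f (charDist θ) := by
  ext x v
  refine and_congr Iff.rfl ?_
  rw [extD_pullForm hθ hf, (hs x).forall]
  refine forall_congr' fun w => ?_
  rw [AlternatingMap.compLinearMap_apply]
  have e : (fun i => (mfderiv I I' f x).toLinearMap (![v, w] i)) =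
      ![mfderiv I I' f x v, mfderiv I I' f x w] := by ext i : 1; fin_cases i <;> rfl
  rw [e]
  rfl

/-- Pullback along a surjection is injective on forms, which keeps the contact volume nonzero; the
power n + 1 of dθ already vanishes on the target, having degree 2n + 2 in dimension 2n + 1. -/
theorem HasClass.pullForm_of_isContactForm {n : ℕ} (hθ : IsContactForm n θ)
    (hf : ContMDiff I I' ∞ f) (hs : ∀ x, Function.Surjective (mfderiv I I' f x)) :
    HasClass n (pullForm I I' f θ) := fun x => by
  constructor
  · rw [classForm_pullForm hθ.smooth hf]
    intro h
    refine hθ.nondegenerate (f x) (AlternatingMap.compLinearMap_injective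
      (mfderiv I I' f x).toLinearMap (hs x) (h.trans ?_))
    rfl
  · rw [extD_pullForm hθ.smooth hf]
    refine (wedgePow_compLinearMap (mfderiv I I' f x).toLinearMap (extD θ (f x)) (n + 1)).trans ?_
    have h := wedgePow_succ_eq_zero (V := TangentSpace I' (f x)) hθ.dim (extD θ (f x))
    exact congrArg (fun L => L.compLinearMap (mfderiv I I' f x).toLinearMap) h

omit [I.Boundaryless] [IsManifold I ∞ M] [I'.Boundaryless] [IsManifold I' ∞ N] in
theorem IsFoliation.pullDist {q : ℕ} {D : TangentDist I' N} (hD : IsFoliation q D)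
    (hf : ContMDiff I I' ∞ f) (hs : ∀ x, Function.Surjective (mfderiv I I' f x)) :
    IsFoliation q (pullDist (I := I) f D) := fun x => by
  obtain ⟨U, hU, hx, φ, hφ, h⟩ := hD (f x)
  refine ⟨f ⁻¹' U, hU.preimage hf.continuous, hx, φ ∘ f, hφ.comp hf.contMDiffOn fun _ h => h,
    fun y hy => ?_⟩
  have e : mfderiv I (𝓡 q) (φ ∘ f) y =
      (mfderiv I' (𝓡 q) φ (f y)).comp (mfderiv I I' f y) :=
    mfderiv_comp y ((hφ.contMDiffAt (hU.mem_nhds hy)).mdifferentiableAt (by simp))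
      (hf.mdifferentiableAt (by simp))
  obtain ⟨h1, h2⟩ := h (f y) hy
  rw [e]
  refine ⟨h1.comp (hs y), ?_⟩
  rw [_root_.pullDist, h2]
  rfl

/-- The zero distribution is tangent to the foliation by points. -/
theorem isFoliation_bot {d : ℕ} {G : Type*} [TopologicalSpace G]
    [ChartedSpace (EuclideanSpace ℝ (Fin d)) G] [IsManifold (𝓡 d) ∞ G]
    {D : TangentDist (𝓡 d) G} (hD : ∀ x, D x = ⊥) : IsFoliation d D := fun x => by
  have : IsManifold (𝓡 d) 1 G := IsManifold.of_le (n := ∞) (by simp)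
  refine ⟨(extChartAt (𝓡 d) x).source, isOpen_extChartAt_source x, mem_extChartAt_source x,
    extChartAt (𝓡 d) x, by rw [extChartAt_source]; exact contMDiffOn_extChartAt, fun y hy => ?_⟩
  have h := (isInvertible_mfderiv_extChartAt hy).bijective
  refine ⟨h.2, ?_⟩
  rw [hD]
  exact (LinearMap.ker_eq_bot.2 h.1).symm

omit [I.Boundaryless] [IsManifold I ∞ M] [I'.Boundaryless] [IsManifold I' ∞ N] in
theorem DefinesFoliation.pullForm {D : TangentDist I' N} (hD : DefinesFoliation θ D)
    (hf : ContMDiff I I' ∞ f) (hs : ∀ x, Function.Surjective (mfderiv I I' f x)) :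
    DefinesFoliation (pullForm I I' f θ) (pullDist f D) := by
  refine ⟨hD.1.pullDist hf hs, fun x => ⟨fun h => (hD.2 (f x)).1 ?_, ?_⟩⟩
  · ext w
    obtain ⟨v, rfl⟩ := hs x w
    exact congrArg (fun L : TangentSpace I x →L[ℝ] ℝ => L v) h
  · rw [pullDist, (hD.2 (f x)).2]
    rfl

omit [I.Boundaryless] [IsManifold I ∞ M] in
theorem ClosedForm.charDist_eq {θ : OneForm I M} {D : TangentDist I M} (hc : ClosedForm θ)
    (hD : DefinesFoliation θ D) : charDist θ = D := by
  ext x v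
  rw [(hD.2 x).2]
  refine and_iff_left fun w => ?_
  rw [hc x]
  rfl

end Submersions

/-! ### Contact pairs on a product. -/

section Product

variable {d e : ℕ} {G₁ : Type*} [TopologicalSpace G₁] [ChartedSpace (EuclideanSpace ℝ (Fin d)) G₁]
  [IsManifold (𝓡 d) ∞ G₁]
  {G₂ : Type*} [TopologicalSpace G₂] [ChartedSpace (EuclideanSpace ℝ (Fin e)) G₂]
  [IsManifold (𝓡 e) ∞ G₂]

omit [IsManifold (𝓡 d) ∞ G₁] [IsManifold (𝓡 e) ∞ G₂] in
theorem mfderiv_fst_surjective (p : G₁ × G₂) :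
    Function.Surjective (mfderiv ((𝓡 d).prod (𝓡 e)) (𝓡 d) (Prod.fst : G₁ × G₂ → G₁) p) := by
  rw [mfderiv_fst]
  exact fun v => ⟨(v, 0), rfl⟩

omit [IsManifold (𝓡 d) ∞ G₁] [IsManifold (𝓡 e) ∞ G₂] in
theorem mfderiv_snd_surjective (p : G₁ × G₂) :
    Function.Surjective (mfderiv ((𝓡 d).prod (𝓡 e)) (𝓡 e) (Prod.snd : G₁ × G₂ → G₂) p) := by
  rw [mfderiv_snd]
  exact fun v => ⟨(0, v), rfl⟩

/-- Contact forms on the factors give a contact pair on the product. -/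
theorem isContactPair_prod {n m : ℕ} {α : OneForm (𝓡 d) G₁} {β : OneForm (𝓡 e) G₂}
    (hα : IsContactForm n α) (hβ : IsContactForm m β) :
    IsContactPair n m (pullForm ((𝓡 d).prod (𝓡 e)) (𝓡 d) (Prod.fst : G₁ × G₂ → G₁) α)
      (pullForm ((𝓡 d).prod (𝓡 e)) (𝓡 e) (Prod.snd : G₁ × G₂ → G₂) β) where
  smooth_left := hα.smooth.pullForm contMDiff_fst
  smooth_right := hβ.smooth.pullForm contMDiff_snd
  dim := by
    rw [Module.finrank_prod, hα.dim, hβ.dim]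
    ring
  class_left := .pullForm_of_isContactForm hα contMDiff_fst mfderiv_fst_surjective
  class_right := .pullForm_of_isContactForm hβ contMDiff_snd mfderiv_snd_surjective
  volume := fun p h => by
    rw [classForm_pullForm hα.smooth contMDiff_fst, classForm_pullForm hβ.smooth contMDiff_snd,
      mfderiv_fst, mfderiv_snd] at h
    obtain ⟨v, hv⟩ := DFunLike.ne_iff.1 (hα.nondegenerate p.1)
    obtain ⟨w, hw⟩ := DFunLike.ne_iff.1 (hβ.nondegenerate p.2)
    have h1 := wedge_fst_snd_apply (V := TangentSpace (𝓡 d) p.1) (W := TangentSpace (𝓡 e) p.2)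
      (classForm n α p.1) (classForm m β p.2) v w
    exact mul_ne_zero hv hw (h1.symm.trans (DFunLike.congr_fun h _))

/-- The kernels of the differentials of the two projections are complementary. -/
theorem isCompl_charDist_prod {n m : ℕ} {α : OneForm (𝓡 d) G₁} {β : OneForm (𝓡 e) G₂}
    (hα : IsContactForm n α) (hβ : IsContactForm m β) (p : G₁ × G₂) :
    IsCompl (charDist (pullForm ((𝓡 d).prod (𝓡 e)) (𝓡 d) (Prod.fst : G₁ × G₂ → G₁) α) p)
      (charDist (pullForm ((𝓡 d).prod (𝓡 e)) (𝓡 e) (Prod.snd : G₁ × G₂ → G₂) β) p) := by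
  rw [charDist_pullForm hα.smooth contMDiff_fst mfderiv_fst_surjective,
    charDist_pullForm hβ.smooth contMDiff_snd mfderiv_snd_surjective, pullDist, pullDist,
    hα.charDist_eq_bot, hβ.charDist_eq_bot, mfderiv_fst, mfderiv_snd]
  -- The kernel of the first projection is the range of `inr`, and that of the second is the range
  -- of `inl`; hence the swap.
  have h := (LinearMap.isCompl_range_inl_inr (R := ℝ) (M := TangentSpace (𝓡 d) p.1)
    (M₂ := TangentSpace (𝓡 e) p.2)).symm
  rw [LinearMap.range_inl, LinearMap.range_inr] at h
  exact h

omit [IsManifold (𝓡 d) ∞ G₁] [IsManifold (𝓡 e) ∞ G₂] in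
theorem linearIndependent_pullForm_fst_snd {α : OneForm (𝓡 d) G₁} {β : OneForm (𝓡 e) G₂}
    {p : G₁ × G₂} (hα : α p.1 ≠ 0) (hβ : β p.2 ≠ 0) :
    LinearIndependent ℝ ![pullForm ((𝓡 d).prod (𝓡 e)) (𝓡 d) (Prod.fst : G₁ × G₂ → G₁) α p,
      pullForm ((𝓡 d).prod (𝓡 e)) (𝓡 e) (Prod.snd : G₁ × G₂ → G₂) β p] := by
  rw [LinearIndependent.pair_iff, pullForm, pullForm, mfderiv_fst, mfderiv_snd]
  intro s t h
  obtain ⟨v, hv⟩ := DFunLike.ne_iff.1 hα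
  obtain ⟨w, hw⟩ := DFunLike.ne_iff.1 hβ
  have h1 : s * α p.1 v + t * β p.2 0 = 0 :=
    congrArg (fun L : EuclideanSpace ℝ (Fin d) × EuclideanSpace ℝ (Fin e) →L[ℝ] ℝ => L (v, 0)) h
  have h2 : s * α p.1 0 + t * β p.2 w = 0 :=
    congrArg (fun L : EuclideanSpace ℝ (Fin d) × EuclideanSpace ℝ (Fin e) →L[ℝ] ℝ => L (0, w)) h
  rw [map_zero, mul_zero, add_zero] at h1
  rw [map_zero, mul_zero, zero_add] at h2
  exact ⟨(mul_eq_zero.1 h1).resolve_right hv, (mul_eq_zero.1 h2).resolve_right hw⟩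

end Product

theorem mainTheorem2 (n m : ℕ)
    {G₁ : Type*} [TopologicalSpace G₁] [ChartedSpace (EuclideanSpace ℝ (Fin (2 * n + 1))) G₁]
    [Group G₁] [LieGroup (𝓡 (2 * n + 1)) ∞ G₁]
    {G₂ : Type*} [TopologicalSpace G₂] [ChartedSpace (EuclideanSpace ℝ (Fin (2 * m + 1))) G₂]
    [Group G₂] [LieGroup (𝓡 (2 * m + 1)) ∞ G₂]
    (hG₁ : KContactLieGroup n G₁) (hG₂ : KContactLieGroup m G₂)
    (F₁ : TangentDist (𝓡 (2 * n + 1)) G₁) (F₂ : TangentDist (𝓡 (2 * m + 1)) G₂)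
    (α₀ : OneForm (𝓡 (2 * n + 1)) G₁) (β₀ : OneForm (𝓡 (2 * m + 1)) G₂)
    (hα₀ : SmoothForm α₀) (hβ₀ : SmoothForm β₀)
    (hα₀_inv : RightInvariant α₀) (hβ₀_inv : RightInvariant β₀)
    (hα₀_closed : ClosedForm α₀) (hβ₀_closed : ClosedForm β₀)
    (h₁ : RMetric (2 * n + 1) G₁) (h₂ : RMetric (2 * m + 1) G₂)
    (hα₀_harm : IsHarmonic h₁ α₀) (hβ₀_harm : IsHarmonic h₂ β₀)
    (hF₁ : DefinesFoliation α₀ F₁) (hF₂ : DefinesFoliation β₀ F₂) :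
    ∃ (α : OneForm (𝓡 (2 * n + 1)) G₁) (β : OneForm (𝓡 (2 * m + 1)) G₂)
      (A B : ℝ → OneForm ((𝓡 (2 * n + 1)).prod (𝓡 (2 * m + 1))) (G₁ × G₂)),
      RightInvariant α ∧ RightInvariant β ∧
      IsLinearDeformation
        (pullForm ((𝓡 (2 * n + 1)).prod (𝓡 (2 * m + 1))) (𝓡 (2 * n + 1)) Prod.fst α₀)
        (pullForm ((𝓡 (2 * n + 1)).prod (𝓡 (2 * m + 1))) (𝓡 (2 * m + 1)) Prod.snd β₀)
        (pullForm ((𝓡 (2 * n + 1)).prod (𝓡 (2 * m + 1))) (𝓡 (2 * n + 1)) Prod.fst α)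
        (pullForm ((𝓡 (2 * n + 1)).prod (𝓡 (2 * m + 1))) (𝓡 (2 * m + 1)) Prod.snd β) A B ∧
      DefinesFoliation (A 0) (pullDist Prod.fst F₁) ∧
      DefinesFoliation (B 0) (pullDist Prod.snd F₂) ∧
      charDist (A 0) = pullDist Prod.fst F₁ ∧ charDist (B 0) = pullDist Prod.snd F₂ ∧
      ∀ t : ℝ, 0 < t →
        IsContactPair n m (A t) (B t) ∧
        IsFoliation (2 * n + 1) (charDist (A t)) ∧ IsFoliation (2 * m + 1) (charDist (B t)) ∧
        ∀ p, IsCompl (charDist (A t) p) (charDist (B t) p) := by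
  obtain ⟨α, hα_inv, hα, hA⟩ := hG₁.exists_deformation hα₀ hα₀_inv hα₀_closed
  obtain ⟨β, hβ_inv, hβ, hB⟩ := hG₂.exists_deformation hβ₀ hβ₀_inv hβ₀_closed
  have hA0 : α₀ + (0 : ℝ) • α = α₀ := by rw [zero_smul, add_zero]
  have hB0 : β₀ + (0 : ℝ) • β = β₀ := by rw [zero_smul, add_zero]
  -- The families are pullbacks of contact forms on the factors; linearity of pullback, definitional
  -- here, identifies them with the required sums.
  refine ⟨α, β, fun t => pullForm _ _ Prod.fst (α₀ + t • α),
    fun t => pullForm _ _ Prod.snd (β₀ + t • β), hα_inv, hβ_inv,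
    ⟨⟨hα₀.pullForm contMDiff_fst, hβ₀.pullForm contMDiff_snd, hα.pullForm contMDiff_fst,
      hβ.pullForm contMDiff_snd⟩, hα₀_closed.pullForm hα₀ contMDiff_fst,
      hβ₀_closed.pullForm hβ₀ contMDiff_snd,
      fun p => linearIndependent_pullForm_fst_snd (hF₁.2 p.1).1 (hF₂.2 p.2).1, fun _ => rfl, fun _ => rfl⟩, ?_⟩
  dsimp only
  rw [hA0, hB0, charDist_pullForm hα₀ contMDiff_fst mfderiv_fst_surjective,
    charDist_pullForm hβ₀ contMDiff_snd mfderiv_snd_surjective, hα₀_closed.charDist_eq hF₁,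
    hβ₀_closed.charDist_eq hF₂]
  refine ⟨hF₁.pullForm contMDiff_fst mfderiv_fst_surjective,
    hF₂.pullForm contMDiff_snd mfderiv_snd_surjective, rfl, rfl, fun t ht =>
    ⟨isContactPair_prod (hA t ht) (hB t ht), ?_, ?_, isCompl_charDist_prod (hA t ht) (hB t ht)⟩⟩
  -- The foliation is by fibres of the projection, the preimage of the foliation of the factor by
  -- points, so its codimension is the dimension of the factor.
  · rw [charDist_pullForm (hA t ht).smooth contMDiff_fst mfderiv_fst_surjective]
    exact (isFoliation_bot (hA t ht).charDist_eq_bot).pullDist contMDiff_fst mfderiv_fst_surjective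
  · rw [charDist_pullForm (hB t ht).smooth contMDiff_snd mfderiv_snd_surjective]
    exact (isFoliation_bot (hB t ht).charDist_eq_bot).pullDist contMDiff_snd mfderiv_snd_surjective
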